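/- Let $K$ be a field and let $n\ge 2$ and $d\ge 1$ be integers. Let $L_n=L_K(1,n)$ be the Leavitt algebra of type $(1,n-1)$, i.e. the quotient of the free associative unital $K$-algebra $K\langle X_1,\dots,X_n,Y_1,\dots,Y_n\rangle$ by the two-sided ideal generated by $X_iY_j-\delta_{ij}1$ $(1\le i,j\le n)$ and $\sum_{j=1}^n Y_jX_j-1$, with the $\mathbb{Z}$-grading induced by $\deg X_i=1$, $\deg Y_i=-1$. Let ${\rm M}_d(L_n)$ be the algebra of $d\times d$ matrices over $L_n$, with the $\mathbb{Z}$-grading in which a matrix is homogeneous of degree $k$ if and only if all its entries are homogeneous of degree $k$ (that is, lie in the degree-$k$ component of $L_n$). Then $L_n$ and ${\rm M}_d(L_n)$ are isomorphic as $\mathbb{Z}$-graded $K$-algebras (there is a unital $K$-algebra isomorphism that maps the degree-$k$ component onto the degree-$k$ component for every $k\in\mathbb{Z}$) if and only if there exists a positive integer $\alpha$ such that $d\mid n^{\alpha}$. -/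

import Mathlib

open scoped DirectSum

/-- The defining relations of the Leavitt algebra, imposed on the free algebra in the `2n`
variables `X_i` (the letters `Sum.inl i`) and `Y_i` (the letters `Sum.inr i`):
`X_i Y_j = δ_{ij}` and `∑_j Y_j X_j = 1`. -/
inductive LeavittRel (K : Type*) [Field K] (n : ℕ) :
    FreeAlgebra K (Fin n ⊕ Fin n) → FreeAlgebra K (Fin n ⊕ Fin n) → Prop
  | xy (i j : Fin n) : LeavittRel K n
      (FreeAlgebra.ι K (Sum.inl i) * FreeAlgebra.ι K (Sum.inr j)) (if i = j then 1 else 0)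
  | yx : LeavittRel K n
      (∑ j : Fin n, FreeAlgebra.ι K (Sum.inr j) * FreeAlgebra.ι K (Sum.inl j)) 1

/-- The Leavitt algebra `L_n = L_K(1, n)`: the quotient of the free associative unital `K`-algebra
`K⟨X_1, …, X_n, Y_1, …, Y_n⟩` by the two-sided ideal generated by the relations above. -/
abbrev LeavittAlgebra (K : Type*) [Field K] (n : ℕ) : Type _ := RingQuot (LeavittRel K n)

namespace LeavittAlgebra

/-- The generators of `L_n`: `gen (Sum.inl i) = x_i` and `gen (Sum.inr i) = y_i`. -/
noncomputable def gen (K : Type*) [Field K] {n : ℕ} (s : Fin n ⊕ Fin n) : LeavittAlgebra K n :=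
  RingQuot.mkAlgHom K (LeavittRel K n) (FreeAlgebra.ι K s)

theorem x_mul_y (K : Type*) [Field K] {n : ℕ} (i j : Fin n) :
    gen K (Sum.inl i) * gen K (Sum.inr j) = if i = j then 1 else 0 := by
  have h := RingQuot.mkAlgHom_rel K (LeavittRel.xy (K := K) i j)
  rw [map_mul] at h
  simp only [gen, h]
  split_ifs <;> simp

theorem sum_y_mul_x (K : Type*) [Field K] (n : ℕ) :
    ∑ j : Fin n, gen K (Sum.inr j) * gen K (Sum.inl j) = 1 := by
  have h := RingQuot.mkAlgHom_rel K (LeavittRel.yx (K := K) (n := n))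
  rw [map_sum, map_one] at h
  simpa only [gen, map_mul] using h

/-- Degrees of the letters: `deg X_i = 1` and `deg Y_i = -1`. -/
def letterDeg {n : ℕ} : Fin n ⊕ Fin n → ℤ
  | Sum.inl _ => 1
  | Sum.inr _ => -1

/-- The `ℤ`-grading of `L_n` induced by `deg X_i = 1`, `deg Y_i = -1`: the component of degree `k`
is the linear span of the (images of the) monomials of degree `k`. -/
def grading (K : Type*) [Field K] (n : ℕ) (k : ℤ) : Submodule K (LeavittAlgebra K n) :=
  Submodule.span K {a | ∃ w : List (Fin n ⊕ Fin n),
    (w.map letterDeg).sum = k ∧ (w.map (gen K)).prod = a}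

theorem gen_mem_grading (K : Type*) [Field K] {n : ℕ} (s : Fin n ⊕ Fin n) :
    gen K s ∈ grading K n (letterDeg s) :=
  Submodule.subset_span ⟨[s], by simp, by simp⟩

instance gradedMonoid (K : Type*) [Field K] (n : ℕ) : SetLike.GradedMonoid (grading K n) where
  one_mem := Submodule.subset_span ⟨[], by simp, by simp⟩
  mul_mem := by
    intro i j a b ha hb
    refine Submodule.span_induction₂ (p := fun a b _ _ => a * b ∈ grading K n (i + j))
      ?_ ?_ ?_ ?_ ?_ ?_ ?_ ha hb
    · rintro _ _ ⟨v, rfl, rfl⟩ ⟨w, rfl, rfl⟩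
      exact Submodule.subset_span ⟨v ++ w, by simp, by simp⟩
    · intro b _; simp
    · intro a _; simp
    · intro a b c _ _ _ h1 h2; rw [add_mul]; exact add_mem h1 h2
    · intro a b c _ _ _ h1 h2; rw [mul_add]; exact add_mem h1 h2
    · intro r a b _ _ h; rw [smul_mul_assoc]; exact Submodule.smul_mem _ r h
    · intro r a b _ _ h; rw [mul_smul_comm]; exact Submodule.smul_mem _ r h

/-- A generator as an element of the external direct sum of the components. -/
noncomputable def genSum (K : Type*) [Field K] {n : ℕ} (s : Fin n ⊕ Fin n) : ⨁ k, grading K n k :=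
  DirectSum.of (fun k => grading K n k) (letterDeg s) ⟨gen K s, gen_mem_grading K s⟩

theorem genSum_mul (K : Type*) [Field K] {n : ℕ} (s t : Fin n ⊕ Fin n) {a : LeavittAlgebra K n}
    (hd : letterDeg s + letterDeg t = 0) (ha : gen K s * gen K t = a) :
    genSum K s * genSum K t = DirectSum.of (fun k => grading K n k) 0
      ⟨a, ha ▸ hd ▸ SetLike.mul_mem_graded (gen_mem_grading K s) (gen_mem_grading K t)⟩ := by
  rw [genSum, genSum, DirectSum.of_mul_of]
  exact DirectSum.of_eq_of_gradedMonoid_eq (Sigma.subtype_ext hd ha)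

theorem genSum_rel (K : Type*) [Field K] (n : ℕ) ⦃a b : FreeAlgebra K (Fin n ⊕ Fin n)⦄
    (h : LeavittRel K n a b) :
    FreeAlgebra.lift K (genSum K) a = FreeAlgebra.lift K (genSum K) b := by
  cases h with
  | xy i j =>
    simp only [map_mul, FreeAlgebra.lift_ι_apply]
    rw [genSum_mul K _ _ (by simp [letterDeg]) (x_mul_y K i j)]
    split_ifs with hij
    · rw [map_one]; rfl
    · rw [map_zero]; exact map_zero (DirectSum.of (fun k => grading K n k) 0)
  | yx =>
    simp only [map_sum, map_mul, FreeAlgebra.lift_ι_apply, map_one]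
    rw [Finset.sum_congr rfl fun j _ => genSum_mul K (Sum.inr j) (Sum.inl j)
      (by simp [letterDeg]) rfl, ← map_sum]
    change _ = DirectSum.of (fun k => grading K n k) 0 1
    congr 1
    apply Subtype.ext
    rw [AddSubmonoidClass.coe_finsetSum]
    exact sum_y_mul_x K n

/-- The algebra homomorphism splitting an element into its homogeneous components. -/
noncomputable def split (K : Type*) [Field K] (n : ℕ) :
    LeavittAlgebra K n →ₐ[K] ⨁ k, grading K n k :=
  RingQuot.liftAlgHom K ⟨FreeAlgebra.lift K (genSum K), genSum_rel K n⟩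

theorem split_gen (K : Type*) [Field K] {n : ℕ} (s : Fin n ⊕ Fin n) :
    split K n (gen K s) = genSum K s := by
  simp [split, gen]

theorem split_word (K : Type*) [Field K] {n : ℕ} (w : List (Fin n ⊕ Fin n))
    (hw : (w.map (gen K)).prod ∈ grading K n (w.map letterDeg).sum) :
    split K n (w.map (gen K)).prod =
      DirectSum.of (fun k => grading K n k) (w.map letterDeg).sum ⟨_, hw⟩ := by
  induction w with
  | nil => exact map_one _
  | cons s w ih =>
    have hw' : (w.map (gen K)).prod ∈ grading K n (w.map letterDeg).sum :=
      Submodule.subset_span ⟨w, rfl, rfl⟩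
    simp only [List.map_cons, List.prod_cons, map_mul, split_gen, ih hw', genSum]
    rw [DirectSum.of_mul_of]
    exact DirectSum.of_eq_of_gradedMonoid_eq (Sigma.subtype_ext (List.sum_cons (a := letterDeg s)).symm rfl)

/-- The Leavitt algebra is a `ℤ`-graded algebra. -/
noncomputable instance gradedAlgebra (K : Type*) [Field K] (n : ℕ) :
    GradedAlgebra (grading K n) :=
  GradedAlgebra.ofAlgHom (grading K n) (split K n)
    (by
      refine RingQuot.ringQuot_ext' K _ _ (FreeAlgebra.hom_ext (funext fun s => ?_))
      change DirectSum.coeAlgHom (grading K n) (split K n (gen K s)) = gen K s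
      rw [split_gen, genSum, DirectSum.coeAlgHom_of])
    (by
      rintro k ⟨a, ha⟩
      change split K n a = _
      induction ha using Submodule.span_induction with
      | mem a h =>
        obtain ⟨w, rfl, rfl⟩ := h
        exact split_word K w _
      | zero => rw [map_zero]; exact (map_zero (DirectSum.of (fun k => grading K n k) k)).symm
      | add a b ha hb h1 h2 => rw [map_add, h1, h2, ← map_add]; rfl
      | smul r a ha h => rw [map_smul, h]; exact (map_smul (DirectSum.lof K ℤ _ k) r _).symm)

end LeavittAlgebra

/-- The grading of the matrix algebra `M_d(A)` over a graded algebra `A`: a matrix is homogeneous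
of degree `k` when all its entries are. -/
def matrixGrading {K A : Type*} [Field K] [Ring A] [Algebra K A] (𝒜 : ℤ → Submodule K A) (d : ℕ)
    (k : ℤ) : Submodule K (Matrix (Fin d) (Fin d) A) where
  carrier := {M | ∀ i j, M i j ∈ 𝒜 k}
  add_mem' hM hN i j := add_mem (hM i j) (hN i j)
  zero_mem' _ _ := zero_mem _
  smul_mem' r _ hM i j := Submodule.smul_mem _ r (hM i j)

namespace matrixGrading

instance gradedMonoid {K A : Type*} [Field K] [Ring A] [Algebra K A] (𝒜 : ℤ → Submodule K A)
    [SetLike.GradedMonoid 𝒜] (d : ℕ) : SetLike.GradedMonoid (matrixGrading 𝒜 d) where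
  one_mem i j := by
    rw [Matrix.one_apply]
    split_ifs
    · exact SetLike.GradedOne.one_mem
    · exact zero_mem _
  mul_mem _ _ M N hM hN i j := by
    rw [Matrix.mul_apply]
    exact sum_mem fun l _ => SetLike.mul_mem_graded (hM i l) (hN l j)

/-- The matrix with a single homogeneous entry. -/
def single {K A : Type*} [Field K] [Ring A] [Algebra K A] (𝒜 : ℤ → Submodule K A) {d : ℕ}
    (i j : Fin d) (k : ℤ) : 𝒜 k →ₗ[K] matrixGrading 𝒜 d k where
  toFun a := ⟨Matrix.single i j (a : A), fun i' j' => by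
    rw [Matrix.single_apply]
    split_ifs
    · exact a.2
    · exact zero_mem _⟩
  map_add' a b := Subtype.ext (Matrix.single_add i j (a : A) b)
  map_smul' r a := Subtype.ext (Matrix.smul_single r i j (a : A)).symm

/-- The entrywise splitting of a matrix into homogeneous components. -/
def split {K A : Type*} [Field K] [Ring A] [Algebra K A] (𝒜 : ℤ → Submodule K A)
    [GradedAlgebra 𝒜] (d : ℕ) : Matrix (Fin d) (Fin d) A →ₗ[K] ⨁ k, matrixGrading 𝒜 d k :=
  ∑ i, ∑ j, (DirectSum.lmap (single 𝒜 i j)).comp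
    ((DirectSum.decomposeLinearEquiv 𝒜).toLinearMap.comp (Matrix.entryLinearMap K A i j))

theorem coe_lmap_single {K A : Type*} [Field K] [Ring A] [Algebra K A] (𝒜 : ℤ → Submodule K A)
    [GradedAlgebra 𝒜] {d : ℕ} (i j : Fin d) (x : ⨁ k, 𝒜 k) :
    DirectSum.coeLinearMap (matrixGrading 𝒜 d) (DirectSum.lmap (single 𝒜 i j) x) =
      Matrix.single i j (DirectSum.coeLinearMap 𝒜 x) := by
  induction x using DirectSum.induction_on with
  | zero => simp
  | of k a =>
    rw [DirectSum.lmap_of, DirectSum.coeLinearMap_of, DirectSum.coeLinearMap_of]; rfl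
  | add x y hx hy => rw [map_add, map_add, hx, hy, map_add, Matrix.single_add]

/-- Matrices over a `ℤ`-graded algebra form a `ℤ`-graded algebra. -/
instance gradedAlgebra {K A : Type*} [Field K] [Ring A] [Algebra K A] (𝒜 : ℤ → Submodule K A)
    [GradedAlgebra 𝒜] (d : ℕ) : GradedAlgebra (matrixGrading 𝒜 d) where
  toDecomposition := DirectSum.Decomposition.ofLinearMap (matrixGrading 𝒜 d) (split 𝒜 d)
    (by
      ext1 M
      have h (a : A) : DirectSum.coeLinearMap 𝒜 (DirectSum.decompose 𝒜 a) = a :=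
        (DirectSum.decompose 𝒜).symm_apply_apply a
      simp only [split, LinearMap.comp_apply, LinearMap.sum_apply, map_sum, coe_lmap_single,
        LinearEquiv.coe_coe, DirectSum.decomposeLinearEquiv_apply, h, Matrix.entryLinearMap_apply,
        LinearMap.id_apply]
      exact (Matrix.matrix_eq_sum_single M).symm)
    (by
      refine DirectSum.linearMap_ext K fun k => LinearMap.ext fun M => ?_
      simp only [split, LinearMap.comp_apply, LinearMap.sum_apply, LinearEquiv.coe_coe,
        DirectSum.decomposeLinearEquiv_apply, Matrix.entryLinearMap_apply, LinearMap.id_apply,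
        DirectSum.lof_eq_of, DirectSum.coeLinearMap_of, DirectSum.decompose_of_mem 𝒜 (M.2 _ _),
        DirectSum.lmap_of]
      simp only [← map_sum]
      congr 1
      apply Subtype.ext
      simp only [AddSubmonoidClass.coe_finsetSum]
      exact (Matrix.matrix_eq_sum_single M.1).symm)

end matrixGrading

/-- Two `ℤ`-graded `K`-algebras are isomorphic as graded algebras when there is a (unital)
`K`-algebra isomorphism carrying each homogeneous component onto the component of the same
degree. -/
def GradedIsomorphic {K A B : Type*} [Field K] [Ring A] [Algebra K A] [Ring B] [Algebra K B]
    (𝒜 : ℤ → Submodule K A) (ℬ : ℤ → Submodule K B) [GradedAlgebra 𝒜] [GradedAlgebra ℬ] : Prop :=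
  ∃ e : A ≃ₐ[K] B, ∀ k : ℤ, (𝒜 k).map e.toLinearMap = ℬ k

/-! Necessity: scalar matrices have degree 0, so a graded isomorphism embeds `M_d(K)` in the
degree-zero part of `L_n`. That part is the increasing union of the subalgebras `core K n N`, and
each of these maps unitally to matrices of size `n ^ N` over `K`. A finite basis of `M_d(K)` lands
in one level, so `M_d(K)` maps unitally to matrices of size `n ^ N`, which forces `d ∣ n ^ N`
(`Matrix.dvd_card_of_algHom`).

Sufficiency: if `d ∣ n`, regrouping the letters gives a graded map `rebracket` from `L_n` to
`M_d(L_n)`. It is injective because no homomorphism to a nonzero algebra kills a nonzero homogeneous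
element (`eq_zero_of_mem_grading`), and surjective because its range contains the matrix units. For
`d ∣ n ^ α`, every prime factor of `d` divides `n`, and `GradedIsomorphic.matrix_mul` composes the
isomorphisms. -/

namespace LeavittAlgebra

/-! ### Universal property and nontriviality -/

variable {K : Type*} [Field K] {n : ℕ}

/-- The algebra homomorphism out of the Leavitt algebra given by elements satisfying the
Leavitt relations. -/
noncomputable def lift {B : Type*} [Ring B] [Algebra K B] (X Y : Fin n → B)
    (hXY : ∀ i j, X i * Y j = if i = j then 1 else 0) (hYX : ∑ j, Y j * X j = 1) :
    LeavittAlgebra K n →ₐ[K] B :=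
  RingQuot.liftAlgHom K ⟨FreeAlgebra.lift K (Sum.elim X Y), by
    intro a b h
    cases h with
    | xy i j =>
      simp only [map_mul, FreeAlgebra.lift_ι_apply, Sum.elim_inl, Sum.elim_inr, hXY]
      split_ifs <;> simp
    | yx => simp [hYX]⟩

theorem lift_gen {B : Type*} [Ring B] [Algebra K B] (X Y : Fin n → B)
    (hXY : ∀ i j, X i * Y j = if i = j then 1 else 0) (hYX : ∑ j, Y j * X j = 1)
    (s : Fin n ⊕ Fin n) : lift (K := K) X Y hXY hYX (gen K s) = Sum.elim X Y s := by
  simp [lift, gen]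

variable (K) in
theorem nontrivial (hn : 1 ≤ n) : Nontrivial (LeavittAlgebra K n) := by
  have : Nonempty (Fin n) := ⟨⟨0, hn⟩⟩
  -- The bijection splits `ℕ` into `n` copies of itself: `X i` restricts a sequence to the `i`-th
  -- copy, and `Y j` extends by zero from the `j`-th.
  obtain ⟨σ⟩ := nonempty_equiv_of_countable (α := Fin n × ℕ) (β := ℕ)
  let X : Fin n → Module.End K (ℕ → K) := fun i => LinearMap.funLeft K K fun t => σ (i, t)
  let Y : Fin n → Module.End K (ℕ → K) := fun j =>
    { toFun := fun f s => if (σ.symm s).1 = j then f (σ.symm s).2 else 0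
      map_add' := fun f g => by ext s; dsimp; split_ifs <;> simp
      map_smul' := fun r f => by ext s; dsimp; split_ifs <;> simp }
  have hXY : ∀ i j, X i * Y j = if i = j then 1 else 0 := by
    intro i j
    refine LinearMap.ext fun f => funext fun t => ?_
    have : (X i * Y j) f t = if i = j then f t else 0 := by
      simp [X, Y, LinearMap.funLeft_apply]
    rw [this]
    split_ifs <;> simp
  have hYX : ∑ j, Y j * X j = 1 := by
    refine LinearMap.ext fun f => funext fun s => ?_
    have (j : Fin n) : (Y j * X j) f s = if (σ.symm s).1 = j then f s else 0 := by
      change (if (σ.symm s).1 = j then f (σ (j, (σ.symm s).2)) else 0) = _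
      split_ifs with h
      · rw [← h]; simp
      · rfl
    rw [LinearMap.sum_apply, Finset.sum_apply, Finset.sum_congr rfl fun j _ => this j]
    simp
  exact (lift (K := K) X Y hXY hYX).toRingHom.domain_nontrivial

theorem eq_sum_mul_y_mul_x (a : LeavittAlgebra K n) :
    a = ∑ j, a * gen K (Sum.inr j) * gen K (Sum.inl j) := by
  simp_rw [mul_assoc]
  rw [← Finset.mul_sum, sum_y_mul_x, mul_one]

theorem eq_sum_y_mul_x_mul (a : LeavittAlgebra K n) :
    a = ∑ i, gen K (Sum.inr i) * (gen K (Sum.inl i) * a) := by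
  simp_rw [← mul_assoc]
  rw [← Finset.sum_mul, sum_y_mul_x, one_mul]

theorem eq_zero_of_mul_y {a : LeavittAlgebra K n} (h : ∀ j, a * gen K (Sum.inr j) = 0) :
    a = 0 := by
  rw [eq_sum_mul_y_mul_x a]; simp [h]

theorem eq_zero_of_x_mul {a : LeavittAlgebra K n} (h : ∀ i, gen K (Sum.inl i) * a = 0) :
    a = 0 := by
  rw [eq_sum_y_mul_x_mul a]; simp [h]

/-! ### The degree-zero component as a union of matricial levels -/

variable (K n) in
/-- The embedding of the Leavitt algebra in its `n × n` matrices, `a ↦ (x_i a y_j)`. -/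
noncomputable def corner : LeavittAlgebra K n →ₐ[K] Matrix (Fin n) (Fin n) (LeavittAlgebra K n) :=
  AlgHom.ofLinearMap
    { toFun := fun a => Matrix.of fun i j => gen K (Sum.inl i) * a * gen K (Sum.inr j)
      map_add' := fun a b => by ext i j; simp [mul_add, add_mul]
      map_smul' := fun r a => by ext i j; simp }
    (by ext i j; simp [x_mul_y, Matrix.one_apply])
    (by
      intro a b
      ext i j
      simp only [LinearMap.coe_mk, AddHom.coe_mk, Matrix.mul_apply, Matrix.of_apply]
      conv_lhs => rw [eq_sum_mul_y_mul_x a]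
      simp only [Finset.sum_mul, Finset.mul_sum, mul_assoc])

theorem corner_apply (a : LeavittAlgebra K n) (i j : Fin n) :
    corner K n a i j = gen K (Sum.inl i) * a * gen K (Sum.inr j) := rfl

variable (K n) in
/-- The subalgebra spanned by the monomials `y_I x_J` with `|I| = |J| = N`. -/
noncomputable def core : ℕ → Subalgebra K (LeavittAlgebra K n)
  | 0 => ⊥
  | N + 1 =>
    { carrier := {a | ∀ i j, corner K n a i j ∈ core N}
      mul_mem' := fun ha hb i j => by
        rw [map_mul, Matrix.mul_apply]
        exact sum_mem fun l _ => mul_mem (ha i l) (hb l j)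
      add_mem' := fun ha hb i j => by
        rw [map_add]; exact add_mem (ha i j) (hb i j)
      algebraMap_mem' := fun r i j => by
        rw [AlgHom.commutes, Matrix.algebraMap_matrix_apply]
        split_ifs
        · exact (core N).algebraMap_mem r
        · exact zero_mem _ }

theorem core_mono : Monotone (core K n) := by
  refine monotone_nat_of_le_succ fun N => ?_
  induction N with
  | zero => exact bot_le
  | succ N ih => exact fun a ha i j => ih (ha i j)

theorem monomial_mem_core (N : ℕ) (I J : List (Fin n)) (hI : I.length = N) (hJ : J.length = N) :
    (I.map fun i => gen K (Sum.inr i)).prod * (J.reverse.map fun j => gen K (Sum.inl j)).prod ∈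
      core K n N := by
  induction N generalizing I J with
  | zero =>
    rw [List.length_eq_zero_iff] at hI hJ
    subst hI hJ
    simp
  | succ N ih =>
    obtain ⟨i', I, rfl⟩ := List.exists_cons_of_length_eq_add_one hI
    obtain ⟨j', J, rfl⟩ := List.exists_cons_of_length_eq_add_one hJ
    intro i j
    -- The index `J` is read backwards, so the heads `i'` and `j'` are the outermost letters, which
    -- `corner` strips off.
    have key : corner K n (((i' :: I).map fun i => gen K (Sum.inr i)).prod *
        ((j' :: J).reverse.map fun j => gen K (Sum.inl j)).prod) i j =
        (gen K (Sum.inl i) * gen K (Sum.inr i')) *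
        ((I.map fun i => gen K (Sum.inr i)).prod *
          (J.reverse.map fun j => gen K (Sum.inl j)).prod) *
        (gen K (Sum.inl j') * gen K (Sum.inr j)) := by
      simp [corner_apply, mul_assoc]
    rw [key, x_mul_y, x_mul_y]
    have := ih I J (by simpa using hI) (by simpa using hJ)
    split_ifs
    · simpa using this
    · simp
    · simp
    · simp

/-- A word in the generators is zero or equal to a normal monomial `y_I x_J`. -/
theorem word_eq_zero_or_monomial (w : List (Fin n ⊕ Fin n)) :
    (w.map (gen K)).prod = 0 ∨ ∃ I J : List (Fin n),
      (w.map (gen K)).prod = (I.map fun i => gen K (Sum.inr i)).prod *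
        (J.reverse.map fun j => gen K (Sum.inl j)).prod ∧
      (w.map letterDeg).sum = (J.length : ℤ) - I.length := by
  induction w with
  | nil => exact Or.inr ⟨[], [], by simp, by simp⟩
  | cons s w ih =>
    rcases ih with h | ⟨I, J, h, hdeg⟩
    · exact Or.inl (by simp [h])
    rcases s with i | i
    · rcases I with _ | ⟨i', I⟩
      · exact Or.inr ⟨[], J ++ [i], by simp [h], by simp [letterDeg, hdeg]; ring⟩
      · have key : ((Sum.inl i :: w).map (gen K)).prod =
            gen K (Sum.inl i) * gen K (Sum.inr i') * ((I.map fun i => gen K (Sum.inr i)).prod *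
              (J.reverse.map fun j => gen K (Sum.inl j)).prod) := by
          simp [h, mul_assoc]
        rw [key, x_mul_y]
        by_cases hi : i = i'
        · exact Or.inr ⟨I, J, by simp [hi], by simp [letterDeg, hdeg]; ring⟩
        · exact Or.inl (by simp [hi])
    · exact Or.inr ⟨i :: I, J, by simp [h, mul_assoc], by simp [letterDeg, hdeg]; ring⟩

/-- In a normal monomial `y_I x_J`, degree zero means `|I| = |J|`. A sum lies in the larger of the
two levels since the levels increase. -/
theorem exists_mem_core {a : LeavittAlgebra K n} (ha : a ∈ grading K n 0) :
    ∃ N, a ∈ core K n N := by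
  induction ha using Submodule.span_induction with
  | mem a h =>
    obtain ⟨w, hw, rfl⟩ := h
    rcases word_eq_zero_or_monomial (K := K) w with h | ⟨I, J, h, hdeg⟩
    · exact ⟨0, h ▸ zero_mem _⟩
    · exact ⟨I.length, h ▸ monomial_mem_core _ I J rfl (by omega)⟩
  | zero => exact ⟨0, zero_mem _⟩
  | add a b _ _ ha hb =>
    obtain ⟨M, hM⟩ := ha
    obtain ⟨N, hN⟩ := hb
    exact ⟨max M N, add_mem (core_mono (le_max_left M N) hM) (core_mono (le_max_right M N) hN)⟩
  | smul r a _ ha =>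
    obtain ⟨M, hM⟩ := ha
    exact ⟨M, Subalgebra.smul_mem _ hM r⟩

/-- The core of level `N` acts on a vector space of dimension `n ^ N`. -/
theorem exists_core_algHom_matrix (hn : 1 ≤ n) (N : ℕ) :
    ∃ (ι : Type) (_ : Fintype ι) (_ : DecidableEq ι), Fintype.card ι = n ^ N ∧
      Nonempty (core K n N →ₐ[K] Matrix ι ι K) := by
  have := nontrivial K hn
  induction N with
  | zero =>
    exact ⟨Unit, inferInstance, inferInstance, by simp,
      ⟨(Algebra.ofId K (Matrix Unit Unit K)).comp
        (Algebra.botEquiv K (LeavittAlgebra K n)).toAlgHom⟩⟩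
  | succ N ih =>
    obtain ⟨ι, _, _, hι, ⟨f⟩⟩ := ih
    -- The entries of `corner` drop one level, so the matrix size is multiplied by `n`.
    let g : core K n (N + 1) →ₐ[K] Matrix (Fin n) (Fin n) (core K n N) :=
      AlgHom.ofLinearMap
        { toFun := fun a => Matrix.of fun i j => ⟨corner K n a i j, a.2 i j⟩
          map_add' := fun a b => by ext i j; simp
          map_smul' := fun r a => by ext i j; simp }
        (by ext i j; simp [Matrix.one_apply]; split_ifs <;> rfl)
        (by
          intro a b
          ext i j
          simp [Matrix.mul_apply])
    exact ⟨Fin n × ι, inferInstance, inferInstance, by simp [hι, pow_succ'],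
      ⟨((Matrix.compAlgEquiv (Fin n) ι K K).toAlgHom.comp f.mapMatrix).comp g⟩⟩

/-! ### Homomorphisms are injective on homogeneous elements -/

theorem eq_zero_of_mem_core {B : Type*} [Ring B] [Nontrivial B] [Algebra K B]
    (f : LeavittAlgebra K n →ₐ[K] B) {N : ℕ} {a : LeavittAlgebra K n} (ha : a ∈ core K n N)
    (h : f a = 0) : a = 0 := by
  induction N generalizing a with
  | zero =>
    obtain ⟨r, rfl⟩ := Algebra.mem_bot.1 ha
    rw [AlgHom.commutes, FaithfulSMul.algebraMap_eq_zero_iff] at h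
    rw [h, map_zero]
  | succ N ih =>
    refine eq_zero_of_x_mul fun i => eq_zero_of_mul_y fun j => ih (ha i j) ?_
    rw [map_mul, map_mul, h, mul_zero, zero_mul]

theorem mul_y_mem {k l : ℤ} {a : LeavittAlgebra K n} (ha : a ∈ grading K n k) (j : Fin n)
    (hl : k = l + 1) : a * gen K (Sum.inr j) ∈ grading K n l := by
  have := SetLike.mul_mem_graded ha (gen_mem_grading K (Sum.inr j))
  rwa [show k + letterDeg (Sum.inr j) = l by simp [letterDeg, hl]] at this

theorem x_mul_mem {k l : ℤ} {a : LeavittAlgebra K n} (ha : a ∈ grading K n k) (i : Fin n)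
    (hl : 1 + k = l) : gen K (Sum.inl i) * a ∈ grading K n l :=
  hl ▸ SetLike.mul_mem_graded (gen_mem_grading K (Sum.inl i)) ha

/-- Right multiplication by the `y_j` lowers a positive degree, left multiplication by the `x_i`
raises a negative one, and neither family kills a nonzero element. This reduces to degree zero. -/
theorem eq_zero_of_mem_grading {B : Type*} [Ring B] [Nontrivial B] [Algebra K B]
    (f : LeavittAlgebra K n →ₐ[K] B) {k : ℤ} {a : LeavittAlgebra K n} (ha : a ∈ grading K n k)
    (h : f a = 0) : a = 0 := by
  induction k generalizing a with
  | zero =>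
    obtain ⟨N, hN⟩ := exists_mem_core ha
    exact eq_zero_of_mem_core f hN h
  | succ k ih =>
    exact eq_zero_of_mul_y fun j => ih (mul_y_mem ha j rfl) (by rw [map_mul, h, zero_mul])
  | pred k ih =>
    exact eq_zero_of_x_mul fun i => ih (x_mul_mem ha i (by ring)) (by rw [map_mul, h, mul_zero])

theorem map_mem_of_gen {B : Type*} [Ring B] [Algebra K B] (ℬ : ℤ → Submodule K B)
    [SetLike.GradedMonoid ℬ] (f : LeavittAlgebra K n →ₐ[K] B)
    (hf : ∀ s, f (gen K s) ∈ ℬ (letterDeg s)) {k : ℤ} {a : LeavittAlgebra K n}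
    (ha : a ∈ grading K n k) : f a ∈ ℬ k := by
  induction ha using Submodule.span_induction with
  | mem a h =>
    obtain ⟨w, rfl, rfl⟩ := h
    induction w with
    | nil => simpa using SetLike.GradedOne.one_mem (A := ℬ)
    | cons s w ih =>
      simpa only [List.map_cons, List.prod_cons, List.sum_cons, map_mul] using
        SetLike.mul_mem_graded (hf s) ih
  | zero => simp
  | add a b _ _ ha hb => rw [map_add]; exact add_mem ha hb
  | smul r a _ ha => rw [map_smul]; exact Submodule.smul_mem _ r ha

end LeavittAlgebra

/-! ### Graded isomorphisms -/

theorem coe_decompose_map {K A B : Type*} [Field K] [Ring A] [Algebra K A] [Ring B] [Algebra K B]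
    (𝒜 : ℤ → Submodule K A) (ℬ : ℤ → Submodule K B) [GradedAlgebra 𝒜] [GradedAlgebra ℬ]
    (f : A →ₐ[K] B) (hf : ∀ k, ∀ a ∈ 𝒜 k, f a ∈ ℬ k) (a : A) (k : ℤ) :
    (DirectSum.decompose ℬ (f a) k : B) = f (DirectSum.decompose 𝒜 a k) := by
  induction a using DirectSum.Decomposition.inductionOn 𝒜 with
  | zero => simp
  | @homogeneous l a =>
    by_cases h : l = k
    · subst h
      rw [DirectSum.decompose_of_mem_same ℬ (hf l a a.2), DirectSum.decompose_of_mem_same 𝒜 a.2]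
    · rw [DirectSum.decompose_of_mem_ne ℬ (hf l a a.2) h, DirectSum.decompose_of_mem_ne 𝒜 a.2 h,
        map_zero]
  | add a b ha hb => simp [DirectSum.decompose_add, ha, hb]

/-- A graded homomorphism commutes with the projections to components, so one inclusion in each
degree already gives equality. -/
theorem GradedIsomorphic.of_bijective {K A B : Type*} [Field K] [Ring A] [Algebra K A] [Ring B]
    [Algebra K B] (𝒜 : ℤ → Submodule K A) (ℬ : ℤ → Submodule K B) [GradedAlgebra 𝒜]
    [GradedAlgebra ℬ] (f : A →ₐ[K] B) (hf : ∀ k, ∀ a ∈ 𝒜 k, f a ∈ ℬ k)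
    (hbij : Function.Bijective f) : GradedIsomorphic 𝒜 ℬ := by
  refine ⟨AlgEquiv.ofBijective f hbij, fun k => le_antisymm ?_ fun b hb => ?_⟩
  · rintro _ ⟨a, ha, rfl⟩
    exact hf k a ha
  · obtain ⟨a, rfl⟩ := hbij.2 b
    refine ⟨DirectSum.decompose 𝒜 a k, SetLike.coe_mem _, ?_⟩
    change f _ = f a
    rw [← coe_decompose_map 𝒜 ℬ f hf, DirectSum.decompose_of_mem_same ℬ hb]

theorem GradedIsomorphic.exists_mem_iff {K A B : Type*} [Field K] [Ring A] [Algebra K A] [Ring B]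
    [Algebra K B] {𝒜 : ℤ → Submodule K A} {ℬ : ℤ → Submodule K B} [GradedAlgebra 𝒜]
    [GradedAlgebra ℬ] (h : GradedIsomorphic 𝒜 ℬ) :
    ∃ e : A ≃ₐ[K] B, ∀ k a, e a ∈ ℬ k ↔ a ∈ 𝒜 k := by
  obtain ⟨e, he⟩ := h
  refine ⟨e, fun k a => ?_⟩
  rw [← he k]
  constructor
  · rintro ⟨b, hb, hab⟩
    rwa [← e.injective hab]
  · exact fun ha => ⟨a, ha, rfl⟩

/-- If `A` is graded isomorphic to its `p × p` and its `d × d` matrices, then it is graded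
isomorphic to its `pd × pd` matrices. -/
theorem GradedIsomorphic.matrix_mul {K A : Type*} [Field K] [Ring A] [Algebra K A]
    {𝒜 : ℤ → Submodule K A} [GradedAlgebra 𝒜] {p d : ℕ}
    (hp : GradedIsomorphic 𝒜 (matrixGrading 𝒜 p)) (hd : GradedIsomorphic 𝒜 (matrixGrading 𝒜 d)) :
    GradedIsomorphic 𝒜 (matrixGrading 𝒜 (p * d)) := by
  obtain ⟨e, he⟩ := hp.exists_mem_iff
  obtain ⟨g, hg⟩ := hd.exists_mem_iff
  let F : A ≃ₐ[K] Matrix (Fin (p * d)) (Fin (p * d)) A :=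
    ((e.trans g.mapMatrix).trans (Matrix.compAlgEquiv (Fin p) (Fin d) A K)).trans
      (Matrix.reindexAlgEquiv K A finProdFinEquiv)
  refine .of_bijective 𝒜 _ F.toAlgHom (fun k a ha i j => ?_) F.bijective
  exact (hg k _).2 ((he k a).2 ha (finProdFinEquiv.symm i).1 (finProdFinEquiv.symm j).1) _ _

/-! ### Divisibility of matrix sizes -/

/-- A unital homomorphism between full matrix algebras over a field forces divisibility. -/
theorem Matrix.dvd_card_of_algHom {K : Type*} [Field K] {d : ℕ} (hd : 1 ≤ d) {ι : Type*}
    [Fintype ι] [DecidableEq ι] (f : Matrix (Fin d) (Fin d) K →ₐ[K] Matrix ι ι K) :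
    d ∣ Fintype.card ι := by
  let o : Fin d := ⟨0, hd⟩
  let E : Fin d → Fin d → Module.End K (ι → K) := fun i j =>
    Matrix.toLinAlgEquiv' (f (Matrix.single i j 1))
  have hE (i j k l : Fin d) : E i j * E k l = if j = k then E i l else 0 := by
    simp only [E, ← map_mul]
    split_ifs with h
    · subst h; simp
    · simp [h]
  have hE' (i j k l : Fin d) (v : ι → K) : E i j (E k l v) = if j = k then E i l v else 0 := by
    rw [← Module.End.mul_apply, hE]
    split_ifs <;> rfl
  have hsum (v : ι → K) : ∑ i, E i i v = v := by
    rw [← LinearMap.sum_apply]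
    simp only [E, ← map_sum]
    rw [Matrix.sum_single_one]
    simp
  -- The matrix units identify `ι → K` with `d` copies of `W` through `v ↦ (E o i v)_i`, with
  -- inverse `w ↦ ∑ i, E i o (w i)`.
  let W := LinearMap.range (E o o)
  have hW (w : W) : E o o w = w := by
    obtain ⟨_, v, rfl⟩ := w
    simp [hE']
  let φ : (ι → K) ≃ₗ[K] (Fin d → W) :=
    LinearEquiv.ofLinearMap
      (LinearMap.pi fun i => (E o i).codRestrict W fun v => ⟨E o i v, by simp [hE']⟩)
      (∑ i, (E i o ∘ₗ W.subtype) ∘ₗ LinearMap.proj i)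
      (by
        refine LinearMap.ext fun w => funext fun i => Subtype.ext ?_
        change E o i ((∑ j, (E j o ∘ₗ W.subtype) ∘ₗ LinearMap.proj j) w) = w i
        simp [LinearMap.sum_apply, hE', hW])
      (by
        refine LinearMap.ext fun v => ?_
        rw [LinearMap.comp_apply, LinearMap.sum_apply]
        change ∑ i, E i o (E o i v) = v
        simp [hE', hsum])
  have := φ.finrank_eq
  rw [Module.finrank_fintype_fun_eq_card, Module.finrank_pi_fintype] at this
  exact ⟨Module.finrank K W, by simpa using this⟩

/-! ### Necessity -/

namespace LeavittAlgebra

variable {K : Type*} [Field K] {n : ℕ}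

theorem exists_dvd_pow_of_gradedIsomorphic (hn : 1 ≤ n) {d : ℕ} (hd : 1 ≤ d)
    (h : GradedIsomorphic (grading K n) (matrixGrading (grading K n) d)) : ∃ N, d ∣ n ^ N := by
  obtain ⟨e, he⟩ := h.exists_mem_iff
  let g : Matrix (Fin d) (Fin d) K →ₐ[K] LeavittAlgebra K n :=
    e.symm.toAlgHom.comp (Algebra.ofId K (LeavittAlgebra K n)).mapMatrix
  have hg (i j : Fin d) : ∃ N, g (Matrix.single i j 1) ∈ core K n N := by
    refine exists_mem_core ((he 0 _).1 fun i' j' => ?_)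
    have : e (g (Matrix.single i j 1)) = Matrix.single i j 1 := by
      simp [g, Matrix.map_single]
    rw [this, Matrix.single_apply]
    split_ifs
    · exact SetLike.GradedOne.one_mem
    · exact zero_mem _
  choose N hN using hg
  -- The sum is a crude common upper bound for the levels.
  let M := ∑ i, ∑ j, N i j
  have hM (i j : Fin d) : g (Matrix.single i j 1) ∈ core K n M :=
    core_mono ((Finset.single_le_sum (f := fun j => N i j) (fun _ _ => Nat.zero_le _)
      (Finset.mem_univ j)).trans (Finset.single_le_sum (f := fun i => ∑ j, N i j)
      (fun _ _ => Nat.zero_le _) (Finset.mem_univ i))) (hN i j)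
  have hgM (A : Matrix (Fin d) (Fin d) K) : g A ∈ core K n M := by
    rw [Matrix.matrix_eq_sum_single A, map_sum]
    refine sum_mem fun i _ => ?_
    rw [map_sum]
    refine sum_mem fun j _ => ?_
    rw [← mul_one (A i j), ← smul_eq_mul, ← Matrix.smul_single, map_smul]
    exact Subalgebra.smul_mem _ (hM i j) _
  obtain ⟨ι, _, _, hι, ⟨f⟩⟩ := exists_core_algHom_matrix (K := K) hn M
  exact ⟨M, hι ▸ Matrix.dvd_card_of_algHom hd (f.comp (g.codRestrict _ hgM))⟩

/-! ### The isomorphism for a divisor of `n` -/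

section Rebracket

variable {d m : ℕ} (σ : Fin d × Fin m ≃ Fin n)

/-- The matrix whose column `k` is `(x_{(i, a)})_i`, for the letter `(k, a)`. -/
noncomputable def matX (K : Type*) [Field K] (s : Fin n) :
    Matrix (Fin d) (Fin d) (LeavittAlgebra K n) :=
  Matrix.of fun i j => if j = (σ.symm s).1 then gen K (Sum.inl (σ (i, (σ.symm s).2))) else 0

/-- The matrix whose row `k` is `(y_{(j, a)})_j`, for the letter `(k, a)`. -/
noncomputable def matY (K : Type*) [Field K] (s : Fin n) :
    Matrix (Fin d) (Fin d) (LeavittAlgebra K n) :=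
  Matrix.of fun i j => if i = (σ.symm s).1 then gen K (Sum.inr (σ (j, (σ.symm s).2))) else 0

theorem matX_mul_matY (s t : Fin n) :
    matX σ K s * matY σ K t = if s = t then 1 else 0 := by
  obtain ⟨⟨k, a⟩, rfl⟩ := σ.surjective s
  obtain ⟨⟨l, b⟩, rfl⟩ := σ.surjective t
  ext i j
  simp only [matX, matY, Matrix.mul_apply, Matrix.of_apply, Equiv.symm_apply_apply, ite_mul,
    zero_mul, Finset.sum_ite_eq', Finset.mem_univ, if_true, mul_ite, mul_zero,
    x_mul_y, σ.injective.eq_iff, Prod.mk.injEq]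
  by_cases hk : k = l <;> by_cases hab : a = b <;> by_cases hij : i = j <;>
    simp [hk, hab, hij, Matrix.one_apply, eq_comm (a := l)]

/-- Only the entry `(k, l)` survives, and it is the sum of `y_s x_s` over all letters `s = (j, a)`,
which is 1. -/
theorem sum_matY_mul_matX_eq_single (k l : Fin d) :
    ∑ a, matY σ K (σ (k, a)) * matX σ K (σ (l, a)) = Matrix.single k l 1 := by
  ext i j
  rw [Matrix.sum_apply]
  simp only [matX, matY, Matrix.mul_apply, Matrix.of_apply, Equiv.symm_apply_apply]
  by_cases hi : i = k
  · by_cases hj : j = l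
    · subst hi hj
      simp only [if_true, Matrix.single_apply_same]
      rw [← sum_y_mul_x K n, ← σ.sum_comp, Fintype.sum_prod_type_right]
    · simp [hj, Ne.symm hj]
  · simp [hi, Ne.symm hi]

theorem sum_matY_mul_matX : ∑ s, matY σ K s * matX σ K s = 1 := by
  rw [← σ.sum_comp, Fintype.sum_prod_type]
  simp only [sum_matY_mul_matX_eq_single]
  exact Matrix.sum_single_one

variable (K) in
/-- The homomorphism `L_n → M_d(L_n)` that regroups the letters of `n = d m`. -/
noncomputable def rebracket :
    LeavittAlgebra K n →ₐ[K] Matrix (Fin d) (Fin d) (LeavittAlgebra K n) :=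
  lift (matX σ K) (matY σ K) (matX_mul_matY σ) (sum_matY_mul_matX σ)

theorem rebracket_mem {k : ℤ} {a : LeavittAlgebra K n} (ha : a ∈ grading K n k) :
    rebracket K σ a ∈ matrixGrading (grading K n) d k := by
  refine map_mem_of_gen _ _ (fun s => ?_) ha
  rw [rebracket, lift_gen]
  rcases s with s | s <;> intro i j
  · simp only [Sum.elim_inl, matX, Matrix.of_apply]
    split_ifs
    · exact gen_mem_grading K (Sum.inl (σ (i, (σ.symm s).2)))
    · exact zero_mem _
  · simp only [Sum.elim_inr, matY, Matrix.of_apply]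
    split_ifs
    · exact gen_mem_grading K (Sum.inr (σ (j, (σ.symm s).2)))
    · exact zero_mem _

/-- The map respects degrees, so an element of the kernel has all its homogeneous components in the
kernel. -/
theorem rebracket_injective (hn : 1 ≤ n) (hd : 1 ≤ d) :
    Function.Injective (rebracket K σ) := by
  have := nontrivial K hn
  have : Nonempty (Fin d) := ⟨⟨0, hd⟩⟩
  rw [injective_iff_map_eq_zero]
  intro a ha
  classical
  rw [← DirectSum.sum_support_decompose (grading K n) a]
  refine Finset.sum_eq_zero fun k _ => ?_
  refine eq_zero_of_mem_grading (rebracket K σ) (SetLike.coe_mem _) ?_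
  rw [← coe_decompose_map (grading K n) (matrixGrading (grading K n) d) (rebracket K σ)
    (fun k a => rebracket_mem σ), ha]
  simp

theorem single_one_mem_range_rebracket (k l : Fin d) :
    Matrix.single k l 1 ∈ (rebracket K σ).range := by
  rw [← sum_matY_mul_matX_eq_single σ]
  exact sum_mem fun a _ => mul_mem ⟨gen K (Sum.inr _), lift_gen ..⟩ ⟨gen K (Sum.inl _), lift_gen ..⟩

/-- Each generator is an entry of some `matX` or `matY`, and the matrix units already in the range
move that entry to position `(k, k)`. -/
theorem single_gen_mem_range_rebracket (k : Fin d) (s : Fin n ⊕ Fin n) :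
    Matrix.single k k (gen K s) ∈ (rebracket K σ).range := by
  rcases s with s | s
  · obtain ⟨⟨b, a⟩, rfl⟩ := σ.surjective s
    have : Matrix.single k k (gen K (Sum.inl (σ (b, a)))) =
        Matrix.single k b 1 * matX σ K (σ (k, a)) * Matrix.single k k 1 := by
      simp [Matrix.single_mul_mul_single, matX]
    rw [this]
    exact mul_mem (mul_mem (single_one_mem_range_rebracket σ k b) ⟨gen K (Sum.inl _), lift_gen ..⟩)
      (single_one_mem_range_rebracket σ k k)
  · obtain ⟨⟨b, a⟩, rfl⟩ := σ.surjective s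
    have : Matrix.single k k (gen K (Sum.inr (σ (b, a)))) =
        Matrix.single k k 1 * matY σ K (σ (k, a)) * Matrix.single b k 1 := by
      simp [Matrix.single_mul_mul_single, matY]
    rw [this]
    exact mul_mem (mul_mem (single_one_mem_range_rebracket σ k k) ⟨gen K (Sum.inr _), lift_gen ..⟩)
      (single_one_mem_range_rebracket σ b k)

theorem rebracket_surjective : Function.Surjective (rebracket K σ) := by
  have hword (k : Fin d) (w : List (Fin n ⊕ Fin n)) :
      Matrix.single k k (w.map (gen K)).prod ∈ (rebracket K σ).range := by
    induction w with
    | nil => simpa using single_one_mem_range_rebracket σ k k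
    | cons s w ih =>
      rw [List.map_cons, List.prod_cons, ← Matrix.single_mul_single_same _ k k k]
      exact mul_mem (single_gen_mem_range_rebracket σ k s) ih
  have hhom (k : Fin d) (z : ℤ) (a : LeavittAlgebra K n) (ha : a ∈ grading K n z) :
      Matrix.single k k a ∈ (rebracket K σ).range := by
    induction ha using Submodule.span_induction with
    | mem a h =>
      obtain ⟨w, -, rfl⟩ := h
      exact hword k w
    | zero => rw [Matrix.single_zero]; exact zero_mem _
    | add a b _ _ ha hb => rw [Matrix.single_add]; exact add_mem ha hb
    | smul r a _ ha => rw [← Matrix.smul_single]; exact Subalgebra.smul_mem _ ha r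
  have hdiag (k : Fin d) (a : LeavittAlgebra K n) :
      Matrix.single k k a ∈ (rebracket K σ).range := by
    induction a using DirectSum.Decomposition.inductionOn (grading K n) with
    | zero => rw [Matrix.single_zero]; exact zero_mem _
    | homogeneous a => exact hhom k _ _ a.2
    | add a b ha hb => rw [Matrix.single_add]; exact add_mem ha hb
  intro M
  change M ∈ (rebracket K σ).range
  rw [Matrix.matrix_eq_sum_single M]
  refine sum_mem fun i _ => sum_mem fun j _ => ?_
  rw [← mul_one (M i j), ← Matrix.single_mul_single_same _ i i j]
  exact mul_mem (hdiag i _) (single_one_mem_range_rebracket σ i j)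

theorem gradedIsomorphic_matrix_of_dvd (hn : 1 ≤ n) (h : d ∣ n) :
    GradedIsomorphic (grading K n) (matrixGrading (grading K n) d) := by
  obtain ⟨m, rfl⟩ := h
  exact .of_bijective _ _ (rebracket K finProdFinEquiv) (fun k a => rebracket_mem _)
    ⟨rebracket_injective _ hn (Nat.pos_of_mul_pos_right hn), rebracket_surjective _⟩

end Rebracket

/-! ### Sufficiency for divisors of powers, and the equivalence -/

theorem gradedIsomorphic_matrix_of_dvd_pow (hn : 1 ≤ n) {α d : ℕ} (h : d ∣ n ^ α) :
    GradedIsomorphic (grading K n) (matrixGrading (grading K n) d) := by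
  induction d using induction_on_primes with
  | zero => exact absurd (Nat.eq_zero_of_zero_dvd h) (by positivity)
  | one => exact gradedIsomorphic_matrix_of_dvd hn (one_dvd n)
  | prime_mul p d hp ih =>
    exact .matrix_mul
      (gradedIsomorphic_matrix_of_dvd hn (hp.dvd_of_dvd_pow ((Dvd.intro _ rfl).trans h)))
      (ih ((Dvd.intro_left _ rfl).trans h))

end LeavittAlgebra

theorem proposition5 (K : Type*) [Field K] (n d : ℕ) (hn : 2 ≤ n) (hd : 1 ≤ d) :
    GradedIsomorphic (LeavittAlgebra.grading K n) (matrixGrading (LeavittAlgebra.grading K n) d) ↔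
      ∃ α : ℕ, 1 ≤ α ∧ d ∣ n ^ α := by
  constructor
  · intro h
    obtain ⟨N, hN⟩ := LeavittAlgebra.exists_dvd_pow_of_gradedIsomorphic (by omega) hd h
    -- The level `N` may be 0, while the exponent must be positive.
    exact ⟨N + 1, by omega, hN.trans (pow_dvd_pow n N.le_succ)⟩
  · rintro ⟨α, -, h⟩
    exact LeavittAlgebra.gradedIsomorphic_matrix_of_dvd_pow (by omega) h
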